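/- Let $L$ be a countable linear ordering. Let $s(x)$ be the immediate successor of $x$ in $L$ if there is one and $s(x)=x$ otherwise, and let $p(x)$ be the immediate predecessor of $x$ if there is one and $p(x)=x$ otherwise. Suppose that the structure $(L,\le,s,p)$ is weakly homogeneous, that is, there is a finite set of elements $a_1,\dots,a_n\in L$ such that every isomorphism between finitely generated substructures of $(L,\le,s,p)$ which maps each $a_i$ to itself extends to an automorphism of $(L,\le,s,p)$. Then the linear ordering $L=(L,\le)$ is relatively $\Delta^0_4$ categorical: whenever $L_1$ and $L_2$ are linear orderings isomorphic to $L$ whose universes are subsets of $\mathbb N$, there is an isomorphism $f:L_1\to L_2$ whose graph is $\Delta^0_4$ relative to $D(L_1)\oplus D(L_2)$, where $D(L_i)=\{\langle a,b\rangle : a,b\in L_i,\ a\le_{L_i} b\}$ is the atomic diagram of $L_i$. -/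

import Mathlib

open FirstOrder

/-- Function symbols of the language of sp-linear orderings: two unary symbols. -/
inductive SPFunc : ℕ → Type
  | s : SPFunc 1
  | p : SPFunc 1

/-- The language of sp-linear orderings: a binary relation symbol for the order together with
unary function symbols for successor and predecessor. -/
def spLanguage : Language := ⟨SPFunc, Language.orderRel⟩

open Classical in
/-- The immediate successor of `x` if there is one, and `x` itself otherwise. -/
noncomputable def spSucc {L : Type*} [LinearOrder L] (x : L) : L :=
  if h : ∃ y, x ⋖ y then h.choose else x

open Classical in
/-- The immediate predecessor of `x` if there is one, and `x` itself otherwise. -/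
noncomputable def spPred {L : Type*} [LinearOrder L] (x : L) : L :=
  if h : ∃ y, y ⋖ x then h.choose else x

/-- The sp-expansion `(L, s, p)` of a linear ordering. -/
@[reducible] noncomputable def spStructure (L : Type*) [LinearOrder L] : spLanguage.Structure L where
  funMap {_} f v :=
    match f, v with
    | SPFunc.s, v => spSucc (v 0)
    | SPFunc.p, v => spPred (v 0)
  RelMap {_} R v :=
    match R, v with
    | Language.orderRel.le, v => v 0 ≤ v 1

/-- `A` is weakly homogeneous: there is a finite exceptional set `E` such that every isomorphism
between finitely generated substructures of `A` which maps each element of `E` to itself extends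
to an automorphism of `A`. -/
def WeaklyHomogeneous (𝓛 : Language) (A : Type*) [𝓛.Structure A] : Prop :=
  ∃ E : Finset A, ∀ S T : 𝓛.Substructure A, S.FG → T.FG → ∀ f : S ≃[𝓛] T,
    (∀ a ∈ E, ∃ ha : a ∈ S, (f ⟨a, ha⟩ : A) = a) →
      ∃ g : A ≃[𝓛] A, ∀ x : S, g x = f x

/-- The sp-expansion of the linear ordering `L` is weakly homogeneous. -/
def WeaklySPHomogeneous (L : Type*) [LinearOrder L] : Prop :=
  letI := spStructure L
  WeaklyHomogeneous spLanguage L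

open Classical in
/-- The arithmetical hierarchy of sets of natural numbers relative to the oracles `O`:
level `0` consists of the sets computable from `O`, and a `Σ⁰ₙ₊₁(O)` set is of the form
`{x | ∃ y, ⟨x, y⟩ ∈ R}` with the complement of `R` in `Σ⁰ₙ(O)` (that is, with `R` in `Π⁰ₙ(O)`). -/
def IsSigma (O : Set (ℕ →. ℕ)) : ℕ → Set ℕ → Prop
  | 0, S => ComputableIn O fun n => decide (n ∈ S)
  | n + 1, S => ∃ R : Set ℕ, IsSigma O n Rᶜ ∧ S = {x | ∃ y, Nat.pair x y ∈ R}

/-- `Π⁰ₙ(O)` sets: complements of `Σ⁰ₙ(O)` sets. -/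
def IsPi (O : Set (ℕ →. ℕ)) (n : ℕ) (S : Set ℕ) : Prop :=
  IsSigma O n Sᶜ

/-- `Δ⁰ₙ(O)` sets. -/
def IsDelta (O : Set (ℕ →. ℕ)) (n : ℕ) (S : Set ℕ) : Prop :=
  IsSigma O n S ∧ IsPi O n S

/-- A linear ordering whose universe is a (finite or infinite) set of natural numbers. The order
is unrelated to the usual order of the natural numbers. -/
structure OrderPresentation where
  carrier : Set ℕ
  order : LinearOrder carrier

namespace OrderPresentation

/-- The elements of a presentation. This is a copy of the subtype of `ℕ` which does not inherit
the usual order of `ℕ`. -/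
def Elem (P : OrderPresentation) : Type := {n : ℕ // n ∈ P.carrier}

instance instLinearOrderElem (P : OrderPresentation) : LinearOrder P.Elem := P.order

/-- The natural number that an element is. -/
def Elem.toNat {P : OrderPresentation} (a : P.Elem) : ℕ := Subtype.val a

open Classical in
/-- The characteristic function of the atomic diagram, as a total function on codes of pairs: the
value at `⟨a, b⟩` is `1` if `a` and `b` are elements with `a ≤ b`, and `0` otherwise.
In particular `a` is an element iff the value at `⟨a, a⟩` is `1`. -/
noncomputable def diagram (P : OrderPresentation) : ℕ → ℕ := fun n =>
  if ∃ a b : P.Elem, n = Nat.pair a.toNat b.toNat ∧ a ≤ b then 1 else 0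

/-- The graph of an isomorphism of presentations, as a set of codes of pairs. -/
def isoGraph {P Q : OrderPresentation} (f : P.Elem ≃o Q.Elem) : Set ℕ :=
  {n | ∃ a : P.Elem, n = Nat.pair a.toNat (f a).toNat}

end OrderPresentation

/-- `L` is relatively `Δ⁰ₙ` categorical: between any two copies `P`, `Q` of `L` there is an
isomorphism which is `Δ⁰ₙ` relative to (the atomic diagrams of) `P` and `Q`. -/
def RelativelyDeltaCategorical (n : ℕ) (L : Type*) [LinearOrder L] : Prop :=
  ∀ P Q : OrderPresentation, Nonempty (L ≃o P.Elem) → Nonempty (L ≃o Q.Elem) →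
    ∃ f : P.Elem ≃o Q.Elem,
      IsDelta {(P.diagram : ℕ →. ℕ), (Q.diagram : ℕ →. ℕ)} n (OrderPresentation.isoGraph f)

/-!
Between two copies of `L` the isomorphism is built by back and forth through finite matchings, that
is, finite partial maps which preserve all atomic formulas of the language of sp-linear orderings.
A matching induces an isomorphism of the generated sp-substructures. Weak homogeneity therefore says
that a finite matching which sends the copies of the exceptional elements to each other is part of
an isomorphism of the two orderings, and so can be extended to any further element.

The level of the construction is that of being a matching. The covering relation is `Π⁰₁` in the
atomic diagram, so the successor and predecessor functions and all words in them are `Δ⁰₃`, and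
quantifying over the words makes the finite matchings `Π⁰₃`, in particular `Δ⁰₄`. Taking the least
suitable extension at every stage is a `Δ⁰₄` recursion. The graph of the limit is `Σ⁰₄`, hence
`Δ⁰₄` because the limit is a total function.
-/

open Encodable

/-! ### Closure properties of the arithmetical hierarchy -/

section RelativizedComputability

variable {α β γ : Type*} [Primcodable α] [Primcodable β] [Primcodable γ] {O : Set (ℕ →. ℕ)}

theorem computableIn_comp {g : β → γ} {f : α → β} (hg : ComputableIn O g)
    (hf : ComputableIn O f) : ComputableIn O fun a => g (f a) := by
  refine Nat.RecursiveIn.of_eq (Nat.RecursiveIn.comp hg hf) fun n => ?_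
  cases h : (decode n : Option α) <;> simp [encodek]

theorem computableIn_prodMk {f : α → β} {g : α → γ} (hf : ComputableIn O f)
    (hg : ComputableIn O g) : ComputableIn O fun a => (f a, g a) := by
  refine Nat.RecursiveIn.of_eq (Nat.RecursiveIn.pair hf hg) fun n => ?_
  cases h : (decode n : Option α) <;> simp [Seq.seq, encode_prod_val]

theorem computableIn_natRec {h : ℕ × ℕ × ℕ → ℕ} (c : ℕ) (hh : ComputableIn O h) :
    ComputableIn O fun x : ℕ × ℕ => (x.2.rec c fun k r => h (x.1, k, r) : ℕ) := by
  have hrec := Nat.RecursiveIn.prec (ComputableIn.const (α := ℕ) (O := O) c) hh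
  refine Nat.RecursiveIn.of_eq hrec fun m => ?_
  have aux : ∀ a k : ℕ,
      (k.rec (Part.some c) fun y IH => IH.bind fun i => Part.some (h (a, y, i)) : Part ℕ) =
        Part.some (k.rec c fun k r => h (a, k, r)) := fun a k => by
    induction k with
    | zero => rfl
    | succ k ih => simp only [ih, Part.bind_some]
  simpa using aux _ _

end RelativizedComputability

namespace IsSigma

variable {O : Set (ℕ →. ℕ)} {n : ℕ} {S T : Set ℕ}

theorem of_computableIn {f : ℕ → Bool} (hf : ComputableIn O f) : IsSigma O 0 {x | f x = true} := by
  rw [IsSigma]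
  convert hf
  simp

open Classical in
theorem computableIn_decide (h : IsSigma O 0 S) : ComputableIn O fun x => decide (x ∈ S) := by
  rwa [IsSigma] at h

theorem compl (h : IsSigma O 0 S) : IsSigma O 0 Sᶜ := by
  convert of_computableIn (computableIn_comp Primrec.not.computableIn h.computableIn_decide)
  ext x
  simp

theorem preimage {f : ℕ → ℕ} (hf : Computable f) (h : IsSigma O n S) :
    IsSigma O n (f ⁻¹' S) := by
  induction n generalizing S f with
  | zero => exact computableIn_comp h hf.computableIn
  | succ n ih =>
    obtain ⟨R, hR, rfl⟩ := h
    let g : ℕ → ℕ := fun x => Nat.pair (f x.unpair.1) x.unpair.2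
    have hg : Computable g := Primrec₂.natPair.to_comp.comp
      (hf.comp (Computable.fst.comp Computable.unpair)) (Computable.snd.comp Computable.unpair)
    refine ⟨g ⁻¹' R, ih hg hR, ?_⟩
    ext x
    simp [g]

theorem succ_of_compl (h : IsSigma O n Sᶜ) : IsSigma O (n + 1) S := by
  refine ⟨(fun x => x.unpair.1) ⁻¹' S, h.preimage (Computable.fst.comp Computable.unpair), ?_⟩
  ext x
  simp

theorem succ (h : IsSigma O n S) : IsSigma O (n + 1) S := by
  induction n generalizing S with
  | zero => exact h.compl.succ_of_compl
  | succ n ih =>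
    obtain ⟨R, hR, rfl⟩ := h
    exact ⟨R, ih hR, rfl⟩

theorem mono {m : ℕ} (h : IsSigma O m S) (hmn : m ≤ n) : IsSigma O n S :=
  Nat.le_induction h (fun _ _ ih => ih.succ) n hmn

theorem union_inter_zero (hS : IsSigma O 0 S) (hT : IsSigma O 0 T) :
    IsSigma O 0 (S ∪ T) ∧ IsSigma O 0 (S ∩ T) := by
  have hST := computableIn_prodMk hS.computableIn_decide hT.computableIn_decide
  constructor
  · convert of_computableIn (computableIn_comp Primrec.or.computableIn₂ hST)
    ext x
    simp
  · convert of_computableIn (computableIn_comp Primrec.and.computableIn₂ hST)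
    ext x
    simp

theorem union_inter (hS : IsSigma O n S) (hT : IsSigma O n T) :
    IsSigma O n (S ∪ T) ∧ IsSigma O n (S ∩ T) := by
  induction n generalizing S T with
  | zero => exact union_inter_zero hS hT
  | succ n ih =>
    obtain ⟨R, hR, rfl⟩ := hS
    obtain ⟨Q, hQ, rfl⟩ := hT
    have hu : Computable Nat.unpair := Computable.unpair
    have hfst : Computable fun x : ℕ => x.unpair.1 := Computable.fst.comp hu
    have hsnd : Computable fun x : ℕ => x.unpair.2 := Computable.snd.comp hu
    refine ⟨⟨R ∪ Q, by rw [Set.compl_union]; exact (ih hR hQ).2, ?_⟩,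
      ⟨{x | Nat.pair x.unpair.1 x.unpair.2.unpair.1 ∈ R} ∩
        {x | Nat.pair x.unpair.1 x.unpair.2.unpair.2 ∈ Q}, ?_, ?_⟩⟩
    · ext x
      simp [exists_or]
    · rw [Set.compl_inter]
      exact (ih (hR.preimage (Primrec₂.natPair.to_comp.comp hfst (hfst.comp hsnd)))
        (hQ.preimage (Primrec₂.natPair.to_comp.comp hfst (hsnd.comp hsnd)))).1
    · ext x
      constructor
      · rintro ⟨⟨y, hy⟩, z, hz⟩
        exact ⟨Nat.pair y z, by simpa using ⟨hy, hz⟩⟩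
      · rintro ⟨y, hy, hz⟩
        exact ⟨⟨_, by simpa using hy⟩, _, by simpa using hz⟩

theorem union (hS : IsSigma O n S) (hT : IsSigma O n T) : IsSigma O n (S ∪ T) :=
  (union_inter hS hT).1

theorem inter (hS : IsSigma O n S) (hT : IsSigma O n T) : IsSigma O n (S ∩ T) :=
  (union_inter hS hT).2

theorem exists_snd (hS : IsSigma O (n + 1) S) :
    IsSigma O (n + 1) {x | ∃ y, Nat.pair x y ∈ S} := by
  obtain ⟨R, hR, rfl⟩ := hS
  have hfst : Computable fun x : ℕ => x.unpair.1 := Computable.fst.comp Computable.unpair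
  have hsnd : Computable fun x : ℕ => x.unpair.2 := Computable.snd.comp Computable.unpair
  have hpair {f g : ℕ → ℕ} (hf : Computable f) (hg : Computable g) :
      Computable fun x => Nat.pair (f x) (g x) := Primrec₂.natPair.to_comp.comp hf hg
  refine ⟨(fun x => Nat.pair (Nat.pair x.unpair.1 x.unpair.2.unpair.1) x.unpair.2.unpair.2) ⁻¹' R,
    hR.preimage (hpair (hpair hfst (hfst.comp hsnd)) (hsnd.comp hsnd)), ?_⟩
  ext x
  simp only [Set.mem_ofPred_eq, Set.mem_preimage, Nat.unpair_pair]
  exact ⟨fun ⟨y, z, h⟩ => ⟨Nat.pair y z, by simpa using h⟩, fun ⟨y, h⟩ => ⟨_, _, h⟩⟩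

theorem exists_lt_zero (h : IsSigma O 0 S) :
    IsSigma O 0 {x | ∃ i < x.unpair.2, Nat.pair x.unpair.1 i ∈ S} := by
  classical
  let f : ℕ × ℕ × ℕ → ℕ := fun x => bif decide (Nat.pair x.1 x.2.1 ∈ S) then 1 else x.2.2
  have hf : ComputableIn O f := by
    have hχ : ComputableIn O fun x : ℕ × ℕ × ℕ => decide (Nat.pair x.1 x.2.1 ∈ S) :=
      computableIn_comp h.computableIn_decide (Primrec₂.natPair.comp Primrec.fst
        (Primrec.fst.comp Primrec.snd)).computableIn
    have hcond : Primrec fun x : Bool × ℕ => bif x.1 then 1 else x.2 :=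
      Primrec.cond Primrec.fst (Primrec.const 1) Primrec.snd
    exact computableIn_comp hcond.computableIn
      (computableIn_prodMk hχ (Primrec.snd.comp Primrec.snd).computableIn)
  have hrec (a k : ℕ) : (k.rec 0 fun j r => f (a, j, r) : ℕ) =
      if ∃ i < k, Nat.pair a i ∈ S then 1 else 0 := by
    induction k with
    | zero => simp
    | succ k ih =>
      simp only [ih, f, Nat.exists_lt_succ_right]
      by_cases hk : Nat.pair a k ∈ S <;> simp [hk]
  convert of_computableIn (computableIn_comp
    (Primrec.beq.comp Primrec.id (Primrec.const 1)).computableIn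
    (computableIn_comp (computableIn_natRec 0 hf) Primrec.unpair.computableIn)) using 3 with x
  simp [hrec]

end IsSigma

/-! ### Arithmetical predicates and functions on encodable types -/

/-- `f` is computable on codes. For encodable `α` and `β` this makes sense without a decision
procedure for the codes of elements of `α`, which `Primcodable` would require. -/
@[fun_prop]
def CodeComputable {α β : Type*} [Encodable α] [Encodable β] (f : α → β) : Prop :=
  ∃ F : ℕ → ℕ, Computable F ∧ ∀ a, encode (f a) = F (encode a)

namespace CodeComputable

variable {α β γ : Type*} [Encodable α] [Encodable β] [Encodable γ]

theorem of_primrec {α' β' : Type*} [Primcodable α'] [Primcodable β'] {f : α → β} (ι : α → α')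
    {g : α' → β'} (hg : Primrec g) (hι : ∀ a, encode (ι a) = encode a)
    (hf : ∀ a, encode (f a) = encode (g (ι a))) : CodeComputable f :=
  ⟨fun m => ((decode m : Option α').map fun a => encode (g a)).getD 0,
    (Primrec.option_getD.comp (Primrec.option_map Primrec.decode
      (Primrec.encode.comp (hg.comp Primrec.snd)).to₂) (Primrec.const 0)).to_comp,
    fun a => by simp [hf, ← hι]⟩

@[fun_prop]
protected theorem id : CodeComputable fun a : α => a := ⟨_, Computable.id, fun _ => rfl⟩

@[fun_prop]
protected theorem const (b : β) : CodeComputable fun _ : α => b :=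
  ⟨fun _ => encode b, Computable.const _, fun _ => rfl⟩

@[fun_prop]
protected theorem comp {g : β → γ} {f : α → β} (hg : CodeComputable g) (hf : CodeComputable f) :
    CodeComputable fun a => g (f a) := by
  obtain ⟨G, hG, hg⟩ := hg
  obtain ⟨F, hF, hf⟩ := hf
  exact ⟨_, hG.comp hF, fun a => by rw [hg, hf]⟩

@[fun_prop]
theorem fst : CodeComputable fun x : α × β => x.1 :=
  ⟨fun m => m.unpair.1, Computable.fst.comp Computable.unpair, fun ⟨_, _⟩ => by simp⟩

@[fun_prop]
theorem snd : CodeComputable fun x : α × β => x.2 :=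
  ⟨fun m => m.unpair.2, Computable.snd.comp Computable.unpair, fun ⟨_, _⟩ => by simp⟩

@[fun_prop]
theorem prodMk {f : α → β} {g : α → γ} (hf : CodeComputable f) (hg : CodeComputable g) :
    CodeComputable fun a => (f a, g a) := by
  obtain ⟨F, hF, hf⟩ := hf
  obtain ⟨G, hG, hg⟩ := hg
  exact ⟨_, Primrec₂.natPair.to_comp.comp hF hG, fun a => by simp [hf, hg]⟩

@[fun_prop]
protected theorem some : CodeComputable fun a : α => some a :=
  ⟨_, Computable.succ, fun _ => rfl⟩

@[fun_prop]
theorem add_one : CodeComputable fun i : ℕ => i + 1 := ⟨_, Computable.succ, fun _ => rfl⟩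

@[fun_prop]
protected theorem encode : CodeComputable fun a : α => encode a :=
  ⟨_, Computable.id, fun _ => rfl⟩

theorem encode_map_encode (l : List α) :
    encode (l.map encode) = encode l := by
  induction l with
  | nil => rfl
  | cons a l ih => simp [ih]

@[fun_prop]
theorem length : CodeComputable fun l : List α => l.length :=
  of_primrec (·.map encode) Primrec.list_length encode_map_encode fun l => by simp

@[fun_prop]
theorem getElem? : CodeComputable fun x : List α × ℕ => x.1[x.2]? :=
  of_primrec (fun x => (x.1.map encode, x.2)) Primrec.list_getElem?
    (fun ⟨_, _⟩ => by simp [encode_map_encode]) fun x => by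
      cases h : x.1[x.2]? <;> simp [h]

end CodeComputable

/-- The predicate `p` on an encodable type is `Σ⁰ₙ(O)`. Only the values of the witnessing set at
codes of elements of `α` matter, so the set of all these codes need not be `Σ⁰ₙ(O)` itself. -/
def SigmaPred {α : Type*} [Encodable α] (O : Set (ℕ →. ℕ)) (n : ℕ) (p : α → Prop) : Prop :=
  ∃ S : Set ℕ, IsSigma O n S ∧ ∀ a, p a ↔ encode a ∈ S

/-- The codes of elements of `α` form a `Σ⁰₁(O)` set, so that quantifiers over `α` can be replaced
by quantifiers over natural numbers in `Σ⁰ₙ₊₁(O)` definitions. -/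
class EnumerableCodes (O : Set (ℕ →. ℕ)) (α : Type*) [Encodable α] : Prop where
  isSigma_range_encode : IsSigma O 1 (Set.range (encode : α → ℕ))

instance {O : Set (ℕ →. ℕ)} {α : Type*} [Primcodable α] : EnumerableCodes O α where
  isSigma_range_encode := by
    obtain ⟨_, h⟩ := Primcodable.mem_range_encode (α := α)
    convert (IsSigma.of_computableIn h.computableIn).succ
    ext m
    simp

instance {O : Set (ℕ →. ℕ)} {α β : Type*} [Encodable α] [Encodable β] [hα : EnumerableCodes O α]
    [hβ : EnumerableCodes O β] : EnumerableCodes O (α × β) where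
  isSigma_range_encode := by
    convert (hα.isSigma_range_encode.preimage (Computable.fst.comp Computable.unpair)).inter
      (hβ.isSigma_range_encode.preimage (Computable.snd.comp Computable.unpair))
    ext x
    constructor
    · rintro ⟨⟨a, b⟩, rfl⟩
      simp
    · rintro ⟨⟨a, ha⟩, b, hb⟩
      exact ⟨(a, b), by simp [ha, hb]⟩

namespace SigmaPred

variable {α β : Type*} [Encodable α] [Encodable β] {O : Set (ℕ →. ℕ)} {n : ℕ} {p q : α → Prop}

theorem of_iff (hq : SigmaPred O n q) (h : ∀ a, p a ↔ q a) : SigmaPred O n p :=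
  (funext fun a => propext (h a) : p = q) ▸ hq

theorem of_primrecRel {R : ℕ → ℕ → Prop} {f g : α → ℕ} (hR : PrimrecRel R)
    (hf : CodeComputable f) (hg : CodeComputable g) : SigmaPred O 0 fun a => R (f a) (g a) := by
  obtain ⟨_, hR⟩ := hR
  obtain ⟨F, hF, hf⟩ := hf
  obtain ⟨G, hG, hg⟩ := hg
  exact ⟨_, IsSigma.of_computableIn (hR.to_comp.comp (hF.pair hG)).computableIn, fun a => by
    simp [← hf, ← hg]⟩

theorem comp {f : β → α} (hp : SigmaPred O n p) (hf : CodeComputable f) :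
    SigmaPred O n fun b => p (f b) := by
  obtain ⟨S, hS, hp⟩ := hp
  obtain ⟨F, hF, hf⟩ := hf
  exact ⟨_, hS.preimage hF, fun b => by simp [hp, hf]⟩

theorem and (hp : SigmaPred O n p) (hq : SigmaPred O n q) : SigmaPred O n fun a => p a ∧ q a := by
  obtain ⟨S, hS, hp⟩ := hp
  obtain ⟨T, hT, hq⟩ := hq
  exact ⟨_, hS.inter hT, fun a => by simp [hp, hq]⟩

theorem or (hp : SigmaPred O n p) (hq : SigmaPred O n q) : SigmaPred O n fun a => p a ∨ q a := by
  obtain ⟨S, hS, hp⟩ := hp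
  obtain ⟨T, hT, hq⟩ := hq
  exact ⟨_, hS.union hT, fun a => by simp [hp, hq]⟩

theorem not_zero (hp : SigmaPred O 0 p) : SigmaPred O 0 fun a => ¬ p a := by
  obtain ⟨S, hS, hp⟩ := hp
  exact ⟨Sᶜ, hS.compl, fun a => by simp [hp]⟩

theorem mono {m : ℕ} (hp : SigmaPred O m p) (hmn : m ≤ n) : SigmaPred O n p := by
  obtain ⟨S, hS, hp⟩ := hp
  exact ⟨S, hS.mono hmn, hp⟩

theorem succ_of_not (hp : SigmaPred O n fun a => ¬ p a) : SigmaPred O (n + 1) p := by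
  obtain ⟨S, hS, hp⟩ := hp
  exact ⟨Sᶜ, IsSigma.succ_of_compl (by rwa [compl_compl]), fun a => by simp [← hp]⟩

theorem ex [hβ : EnumerableCodes O β] {r : α → β → Prop}
    (hr : SigmaPred O (n + 1) fun x : α × β => r x.1 x.2) :
    SigmaPred O (n + 1) fun a => ∃ b, r a b := by
  obtain ⟨S, hS, hr⟩ := hr
  have hcode : IsSigma O (n + 1) {m | m.unpair.2 ∈ Set.range (encode : β → ℕ)} :=
    (hβ.isSigma_range_encode.mono (by omega)).preimage (Computable.snd.comp Computable.unpair)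
  exact ⟨_, (hS.inter hcode).exists_snd, fun a => by simp [hr (a, _)]⟩

theorem eq {f g : α → β} (hf : CodeComputable f) (hg : CodeComputable g) :
    SigmaPred O n fun a => f a = g a := by
  have h : SigmaPred O 0 fun a => encode (f a) = encode (g a) :=
    of_primrecRel Primrec.eq (by fun_prop) (by fun_prop)
  simpa only [encode_inj] using h.mono n.zero_le

theorem exists_matrix (hp : SigmaPred O (n + 1) p) :
    ∃ r : α → ℕ → Prop, (SigmaPred O n fun x : α × ℕ => ¬ r x.1 x.2) ∧ ∀ a, p a ↔ ∃ m, r a m := by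
  obtain ⟨S, ⟨R, hR, rfl⟩, hp⟩ := hp
  exact ⟨fun a m => encode (a, m) ∈ R, ⟨Rᶜ, hR, fun _ => Iff.rfl⟩, fun a => by simp [hp]⟩

theorem exists_lt {p : α → ℕ → Prop} {g : α → ℕ} (hg : CodeComputable g)
    (hp : SigmaPred O n fun x : α × ℕ => p x.1 x.2) : SigmaPred O n fun a => ∃ i < g a, p a i := by
  cases n with
  | zero =>
    obtain ⟨S, hS, hp⟩ := hp
    have hbound : SigmaPred O 0 fun x : α × ℕ => ∃ i < x.2, p x.1 i :=
      ⟨_, hS.exists_lt_zero, fun ⟨a, k⟩ => by simp [hp (a, _)]⟩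
    exact hbound.comp (f := fun a => (a, g a)) (by fun_prop)
  | succ n =>
    have hlt : SigmaPred O 0 fun x : α × ℕ => x.2 < g x.1 :=
      of_primrecRel Primrec.nat_lt (by fun_prop) (by fun_prop)
    exact ((hlt.mono (by omega)).and hp).ex

theorem forall_lt {p : α → ℕ → Prop} {g : α → ℕ} (hg : CodeComputable g)
    (hp : SigmaPred O n fun x : α × ℕ => p x.1 x.2) : SigmaPred O n fun a => ∀ i < g a, p a i := by
  cases n with
  | zero => simpa using (exists_lt (p := fun a i => ¬ p a i) hg hp.not_zero).not_zero
  | succ n =>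
    obtain ⟨r, hr, hp⟩ := hp.exists_matrix
    have hgetD : CodeComputable fun x : List ℕ × ℕ => x.1.getD x.2 0 :=
      .of_primrec id (Primrec.list_getD 0) (fun _ => rfl) fun _ => rfl
    have hmatrix : SigmaPred O n fun x : α × List ℕ => ∃ i < g x.1, ¬ r (x.1, i) (x.2.getD i 0) :=
      exists_lt (by fun_prop) (hr.comp (f := fun x : (α × List ℕ) × ℕ =>
        ((x.1.1, x.2), x.1.2.getD x.2 0))
        (by fun_prop))
    -- Collection: witnesses for all `i < g a` can be listed in a single word `w`.
    have hchoice (a : α) : (∀ i < g a, p a i) ↔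
        ∃ w : List ℕ, ∀ i < g a, r (a, i) (w.getD i 0) := by
      refine ⟨fun h => ?_, fun ⟨w, hw⟩ i hi => (hp (a, i)).2 ⟨_, hw i hi⟩⟩
      choose! m hm using fun i hi => (hp (a, i)).1 (h i hi)
      exact ⟨(List.range (g a)).map m, fun i hi => by simpa [List.getD, hi] using hm i hi⟩
    exact (succ_of_not (by simpa using hmatrix)).ex.of_iff hchoice

end SigmaPred

instance {O : Set (ℕ →. ℕ)} {α : Type*} [Encodable α] [hα : EnumerableCodes O α] :
    EnumerableCodes O (List α) where
  isSigma_range_encode := by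
    have hrange : SigmaPred O 1 fun m : ℕ => m ∈ Set.range (encode : α → ℕ) :=
      ⟨_, hα.isSigma_range_encode, fun _ => Iff.rfl⟩
    have hcode : SigmaPred O 1 fun m : ℕ => ∃ l : List ℕ, encode l = m ∧
        ∀ i < l.length, ∃ c, l[i]? = some c ∧ c ∈ Set.range (encode : α → ℕ) :=
      ((SigmaPred.eq (by fun_prop) (by fun_prop)).and (.forall_lt (by fun_prop) (.ex
        ((SigmaPred.eq (by fun_prop) (by fun_prop)).and (hrange.comp (by fun_prop)))))).ex
    obtain ⟨S, hS, hcode⟩ := hcode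
    convert hS
    ext m
    refine Iff.trans ⟨?_, ?_⟩ (hcode m)
    · rintro ⟨l, rfl⟩
      refine ⟨l.map encode, CodeComputable.encode_map_encode l, fun i hi => ?_⟩
      rw [List.length_map] at hi
      exact ⟨_, by simp [hi], l[i], rfl⟩
    · rintro ⟨l, rfl, hl⟩
      obtain ⟨l, rfl⟩ : l ∈ Set.range (List.map (encode : α → ℕ)) := by
        rw [Set.range_list_map]
        intro c hc
        obtain ⟨i, hi, rfl⟩ := List.mem_iff_getElem.1 hc
        obtain ⟨c, hc, hrange⟩ := hl i hi
        rw [List.getElem?_eq_getElem hi, Option.some_inj] at hc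
        exact hc ▸ hrange
      exact ⟨l, (CodeComputable.encode_map_encode l).symm⟩

/-- The predicate `p` on an encodable type is `Δ⁰ₙ(O)`. -/
def DeltaPred {α : Type*} [Encodable α] (O : Set (ℕ →. ℕ)) (n : ℕ) (p : α → Prop) : Prop :=
  SigmaPred O n p ∧ SigmaPred O n fun a => ¬ p a

theorem SigmaPred.deltaPred_succ {α : Type*} [Encodable α] {O : Set (ℕ →. ℕ)} {n : ℕ} {p : α → Prop}
    (hp : SigmaPred O n p) : DeltaPred O (n + 1) p :=
  ⟨hp.mono n.le_succ, succ_of_not (by simpa using hp)⟩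

namespace DeltaPred

variable {α β : Type*} [Encodable α] [Encodable β] {O : Set (ℕ →. ℕ)} {n : ℕ} {p q : α → Prop}

theorem comp {f : β → α} (hp : DeltaPred O n p) (hf : CodeComputable f) :
    DeltaPred O n fun b => p (f b) :=
  ⟨hp.1.comp hf, hp.2.comp hf⟩

theorem mono {m : ℕ} (hp : DeltaPred O m p) (hmn : m ≤ n) : DeltaPred O n p :=
  ⟨hp.1.mono hmn, hp.2.mono hmn⟩

theorem not (hp : DeltaPred O n p) : DeltaPred O n fun a => ¬ p a :=
  ⟨hp.2, by simpa using hp.1⟩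

theorem and (hp : DeltaPred O n p) (hq : DeltaPred O n q) : DeltaPred O n fun a => p a ∧ q a :=
  ⟨hp.1.and hq.1, by simpa only [not_and_or] using hp.2.or hq.2⟩

theorem or (hp : DeltaPred O n p) (hq : DeltaPred O n q) : DeltaPred O n fun a => p a ∨ q a :=
  ⟨hp.1.or hq.1, by simpa only [not_or] using hp.2.and hq.2⟩

theorem imp (hp : DeltaPred O n p) (hq : DeltaPred O n q) : DeltaPred O n fun a => p a → q a := by
  simpa only [imp_iff_not_or] using hp.not.or hq

theorem iff (hp : DeltaPred O n p) (hq : DeltaPred O n q) : DeltaPred O n fun a => (p a ↔ q a) := by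
  simpa only [iff_iff_implies_and_implies] using (hp.imp hq).and (hq.imp hp)

theorem eq {f g : α → β} (hf : CodeComputable f) (hg : CodeComputable g) :
    DeltaPred O n fun a => f a = g a :=
  ⟨.eq hf hg, (SigmaPred.eq hf hg).not_zero.mono n.zero_le⟩

theorem ex [EnumerableCodes O β] {r : α → β → Prop}
    (hr : DeltaPred O (n + 1) fun x : α × β => r x.1 x.2) :
    DeltaPred O (n + 2) fun a => ∃ b, r a b :=
  hr.1.ex.deltaPred_succ

theorem all [EnumerableCodes O β] {r : α → β → Prop}
    (hr : DeltaPred O (n + 1) fun x : α × β => r x.1 x.2) :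
    DeltaPred O (n + 2) fun a => ∀ b, r a b := by
  simpa only [not_exists, not_not] using (ex (r := fun a b => ¬ r a b) hr.not).not

theorem exists_lt {p : α → ℕ → Prop} {g : α → ℕ} (hg : CodeComputable g)
    (hp : DeltaPred O n fun x : α × ℕ => p x.1 x.2) : DeltaPred O n fun a => ∃ i < g a, p a i :=
  ⟨.exists_lt hg hp.1, by simpa using SigmaPred.forall_lt (p := fun a i => ¬ p a i) hg hp.2⟩

theorem mem {f : α → β} {l : α → List β} (hf : CodeComputable f) (hl : CodeComputable l) :
    DeltaPred O n fun a => f a ∈ l a := by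
  have hmem (a : α) : f a ∈ l a ↔ ∃ i < (l a).length, (l a)[i]? = some (f a) := by
    rw [List.mem_iff_getElem?]
    exact exists_congr fun i => ⟨fun h => ⟨(List.getElem?_eq_some_iff.1 h).1, h⟩, And.right⟩
  simp only [hmem]
  exact exists_lt (by fun_prop) (eq (by fun_prop) (by fun_prop))

theorem subset [EnumerableCodes O β] {l l' : α → List β} (hl : CodeComputable l)
    (hl' : CodeComputable l') : DeltaPred O (n + 2) fun a => l a ⊆ l' a :=
  all (imp (mem (by fun_prop) (by fun_prop)) (mem (by fun_prop) (by fun_prop)))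

theorem exists_encode_eq [hβ : EnumerableCodes O β] {r : α → β → Prop} {g : α → ℕ}
    (hg : CodeComputable g) (hr : DeltaPred O (n + 2) fun x : α × β => r x.1 x.2) :
    DeltaPred O (n + 2) fun a => ∃ b, encode b = g a ∧ r a b := by
  -- At most one element has code `g a`, so the negation is also existential.
  have hdecode : DeltaPred O (n + 2) fun a => ∃ b : β, encode b = g a :=
    ex (eq (by fun_prop) (by fun_prop))
  have hfalse : SigmaPred O (n + 2) fun a => ∃ b, encode b = g a ∧ ¬ r a b :=
    ((SigmaPred.eq (by fun_prop) (by fun_prop)).and hr.2).ex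
  refine ⟨((SigmaPred.eq (by fun_prop) (by fun_prop)).and hr.1).ex, ?_⟩
  convert hdecode.2.or hfalse using 2 with a
  constructor
  · intro h
    by_contra! hcon
    obtain ⟨⟨b, hb⟩, hb'⟩ := hcon
    exact h ⟨b, hb, hb' b hb⟩
  · rintro (h | ⟨b, hb, hb'⟩) ⟨c, hc, hc'⟩
    · exact h ⟨c, hc⟩
    · exact hb' (encode_injective (hc.trans hb.symm) ▸ hc')

theorem forall_encode_eq [EnumerableCodes O β] {r : α → β → Prop} {g : α → ℕ}
    (hg : CodeComputable g) (hr : DeltaPred O (n + 2) fun x : α × β => r x.1 x.2) :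
    DeltaPred O (n + 2) fun a => ∀ b, encode b = g a → r a b := by
  simpa only [not_exists, not_and, not_not] using
    (exists_encode_eq (r := fun a b => ¬ r a b) hg hr.not).not

theorem isDelta_image [EnumerableCodes O α] (hp : DeltaPred O (n + 2) p) :
    IsDelta O (n + 2) (encode '' {a | p a}) := by
  have h : DeltaPred O (n + 2) fun m : ℕ => ∃ a, encode a = m ∧ p a :=
    exists_encode_eq (by fun_prop) (hp.comp (by fun_prop))
  obtain ⟨⟨S, hS, hS'⟩, T, hT, hT'⟩ := h
  constructor
  · convert hS
    ext m
    simpa [and_comm] using hS' m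
  · rw [IsPi]
    convert hT
    ext m
    simpa [and_comm] using hT' m

end DeltaPred

/-- `f` is a `Δ⁰ₙ(O)` function. Since `f` is total, it is enough for `n ≥ 1` to ask that its graph
is `Σ⁰ₙ(O)`. -/
def DeltaFun {α β : Type*} [Encodable α] [Encodable β] (O : Set (ℕ →. ℕ)) (n : ℕ) (f : α → β) :
    Prop :=
  SigmaPred O n fun x : α × β => f x.1 = x.2

section DeltaFun

variable {α β γ : Type*} [Encodable α] [Encodable β] [Encodable γ] {O : Set (ℕ →. ℕ)} {n : ℕ}

theorem SigmaPred.comp_deltaFun [EnumerableCodes O β] {r : α → β → Prop} {f : α → β}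
    (hr : SigmaPred O (n + 1) fun x : α × β => r x.1 x.2) (hf : DeltaFun O (n + 1) f) :
    SigmaPred O (n + 1) fun a => r a (f a) := by
  have h : SigmaPred O (n + 1) fun a => ∃ b, f a = b ∧ r a b := (SigmaPred.and hf hr).ex
  simpa only [exists_eq_left'] using h

theorem DeltaPred.comp_deltaFun [EnumerableCodes O β] {r : α → β → Prop} {f : α → β}
    (hr : DeltaPred O (n + 1) fun x : α × β => r x.1 x.2) (hf : DeltaFun O (n + 1) f) :
    DeltaPred O (n + 1) fun a => r a (f a) :=
  ⟨hr.1.comp_deltaFun hf, SigmaPred.comp_deltaFun (r := fun a b => ¬ r a b) hr.2 hf⟩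

theorem DeltaPred.exists_deltaFun [EnumerableCodes O β] {r : α → β → Prop}
    (hr : DeltaPred O (n + 2) fun x : α × β => r x.1 x.2) (hex : ∀ a, ∃ b, r a b) :
    ∃ f : α → β, DeltaFun O (n + 2) f ∧ ∀ a, r a (f a) := by
  have hmin (a : α) : ∃ b, r a b ∧ ¬ ∃ i < encode b, ∃ c, encode c = i ∧ r a c := by
    obtain ⟨b, hb, hmin⟩ :=
      (InvImage.wf (encode : β → ℕ) wellFounded_lt).has_min {b | r a b} (hex a)
    exact ⟨b, hb, fun ⟨_, hi, c, hc, hrc⟩ => hmin c hrc (by simpa [InvImage, hc] using hi)⟩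
  choose f hf hf_min using hmin
  have hgraph (a : α) (b : β) :
      f a = b ↔ r a b ∧ ¬ ∃ i < encode b, ∃ c, encode c = i ∧ r a c := by
    constructor
    · rintro rfl
      exact ⟨hf a, hf_min a⟩
    · rintro ⟨hb, hb_min⟩
      by_contra hne
      rcases lt_or_gt_of_ne (encode_injective.ne hne) with h | h
      exacts [hb_min ⟨_, h, _, rfl, hf a⟩, hf_min a ⟨_, h, _, rfl, hb⟩]
  refine ⟨f, ?_, hf⟩
  simp only [DeltaFun, hgraph]
  exact (hr.and (exists_lt (by fun_prop)
    (exists_encode_eq (by fun_prop)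
      (hr.comp (f := fun x : ((α × β) × ℕ) × β => (x.1.1.1, x.2)) (by fun_prop)))).not).1

namespace DeltaFun

theorem of_codeComputable {f : α → β} (hf : CodeComputable f) : DeltaFun O n f :=
  SigmaPred.eq (by fun_prop) (by fun_prop)

theorem comp {g : β → γ} {f : α → β} (hg : DeltaFun O n g) (hf : CodeComputable f) :
    DeltaFun O n fun a => g (f a) :=
  SigmaPred.comp hg (f := fun x : α × γ => (f x.1, x.2)) (by fun_prop)

theorem comp_eq {f : β → γ} {g : α → β} {h : α → γ} (hf : DeltaFun O n f)
    (hg : CodeComputable g) (hh : CodeComputable h) : SigmaPred O n fun a => f (g a) = h a :=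
  SigmaPred.comp hf (f := fun a => (g a, h a)) (by fun_prop)

theorem deltaPred_graph [EnumerableCodes O β] {f : α → β} (hf : DeltaFun O (n + 1) f) :
    DeltaPred O (n + 1) fun x : α × β => f x.1 = x.2 :=
  DeltaPred.comp_deltaFun (f := fun x : α × β => f x.1) (r := fun x b => b = x.2)
    (.eq (by fun_prop) (by fun_prop)) (hf.comp (by fun_prop))

theorem natRec [EnumerableCodes O β] {f : α → β} {g : α × ℕ × β → β}
    (hf : DeltaFun O (n + 1) f) (hg : DeltaFun O (n + 1) g) :
    DeltaFun O (n + 1) fun x : α × ℕ => (x.2.rec (f x.1) fun i b => g (x.1, i, b) : β) := by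
  let F (a : α) (k : ℕ) : β := k.rec (f a) fun i b => g (a, i, b)
  have hstart : SigmaPred O (n + 1) fun x : ((α × ℕ) × β) × List β =>
      ∃ b, f x.1.1.1 = b ∧ x.2[0]? = some b :=
    .ex (.and (hf.comp_eq (by fun_prop) (by fun_prop)) (.eq (by fun_prop) (by fun_prop)))
  have hstep : SigmaPred O (n + 1) fun x : (((α × ℕ) × β) × List β) × ℕ =>
      ∃ b c, x.1.2[x.2]? = some b ∧ x.1.2[x.2 + 1]? = some c ∧ g (x.1.1.1.1, x.2, b) = c :=
    .ex (.ex (.and (.eq (by fun_prop) (by fun_prop)) (.and (.eq (by fun_prop) (by fun_prop))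
      (hg.comp_eq (by fun_prop) (by fun_prop)))))
  have htrace : SigmaPred O (n + 1) fun x : (α × ℕ) × β => ∃ w : List β,
      (∃ b, f x.1.1 = b ∧ w[0]? = some b) ∧ w[x.1.2]? = some x.2 ∧
        ∀ i < x.1.2, ∃ b c, w[i]? = some b ∧ w[i + 1]? = some c ∧ g (x.1.1, i, b) = c :=
    .ex (hstart.and (.and (.eq (by fun_prop) (by fun_prop)) (.forall_lt (by fun_prop) hstep)))
  refine htrace.of_iff fun ⟨⟨a, k⟩, y⟩ => ?_
  constructor
  · rintro (rfl : F a k = y)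
    have hw (i : ℕ) (hi : i ≤ k) : ((List.range (k + 1)).map (F a))[i]? = some (F a i) := by
      simp [Nat.lt_succ_of_le hi]
    exact ⟨(List.range (k + 1)).map (F a), ⟨_, rfl, hw 0 k.zero_le⟩, hw k le_rfl,
      fun i hi => ⟨_, _, hw i hi.le, hw (i + 1) hi, rfl⟩⟩
  · rintro ⟨w, ⟨_, rfl, hw0⟩, hwk, hw⟩
    have hFw (i : ℕ) (hi : i ≤ k) : w[i]? = some (F a i) := by
      induction i with
      | zero => exact hw0
      | succ i ih =>
        obtain ⟨b, _, hb, hc, rfl⟩ := hw i hi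
        rw [ih (by omega), Option.some_inj] at hb
        rw [hc, ← hb]
    exact Option.some_injective _ ((hFw k le_rfl).symm.trans hwk)

theorem foldl [EnumerableCodes O β] [EnumerableCodes O γ] {f : β → γ → β}
    (hf : DeltaFun O (n + 1) fun x : β × γ => f x.1 x.2) :
    DeltaFun O (n + 1) fun x : List γ × β => x.1.foldl f x.2 := by
  let g : (List γ × β) × ℕ × β → β := fun x => (x.1.1[x.2.1]?).elim x.2.2 (f x.2.2)
  have hg : DeltaFun O (n + 1) g := by
    have hcases : SigmaPred O (n + 1) fun x : ((List γ × β) × ℕ × β) × β =>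
        (x.1.1.1[x.1.2.1]? = none ∧ x.1.2.2 = x.2) ∨
          ∃ c, x.1.1.1[x.1.2.1]? = some c ∧ f x.1.2.2 c = x.2 :=
      .or (.and (.eq (by fun_prop) (by fun_prop)) (.eq (by fun_prop) (by fun_prop)))
        (.ex (.and (.eq (by fun_prop) (by fun_prop))
          (hf.comp_eq (g := fun x : (((List γ × β) × ℕ × β) × β) × γ => (x.1.1.2.2, x.2))
            (by fun_prop) (by fun_prop))))
    refine hcases.of_iff fun ⟨⟨⟨l, _⟩, i, _⟩, _⟩ => ?_
    cases h : l[i]? <;> simp [g, h]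
  have hrec (l : List γ) (b : β) (k : ℕ) :
      (k.rec b fun i c => g ((l, b), i, c) : β) = (l.take k).foldl f b := by
    induction k with
    | zero => simp
    | succ k ih =>
      simp only [ih, g, List.take_add_one, List.foldl_append]
      cases l[k]? <;> rfl
  have hlength := (natRec (of_codeComputable .snd) hg).comp
    (f := fun x : List γ × β => (x, x.1.length)) (by fun_prop)
  simpa only [hrec, List.take_length] using hlength

end DeltaFun

end DeltaFun

theorem DeltaPred.exists_deltaFun_chain {β : Type*} [Encodable β] {O : Set (ℕ →. ℕ)} {n : ℕ}
    [EnumerableCodes O β] {r : ℕ × β → β → Prop}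
    (hr : DeltaPred O (n + 2) fun x : (ℕ × β) × β => r x.1 x.2) (hex : ∀ a, ∃ b, r a b) (b₀ : β) :
    ∃ F : ℕ → β, DeltaFun O (n + 2) F ∧ F 0 = b₀ ∧ ∀ i, r (i, F i) (F (i + 1)) := by
  obtain ⟨step, hstep, hr_step⟩ := hr.exists_deltaFun hex
  have hrec := DeltaFun.natRec (f := fun _ : Unit => b₀) (g := fun x => step x.2)
    (.of_codeComputable (by fun_prop)) (hstep.comp (by fun_prop))
  exact ⟨fun k => k.rec b₀ fun i b => step (i, b),
    hrec.comp (f := fun k => ((), k)) (by fun_prop), rfl, fun i => hr_step _⟩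

/-! ### Effective back and forth -/

theorem exists_orderIso_of_rel {α β : Type*} [PartialOrder α] [PartialOrder β] {r : α → β → Prop}
    (left_total : ∀ a, ∃ b, r a b) (right_total : ∀ b, ∃ a, r a b)
    (le_iff_le : ∀ a b, r a b → ∀ a' b', r a' b' → (a ≤ a' ↔ b ≤ b')) :
    ∃ e : α ≃o β, ∀ a b, r a b ↔ e a = b := by
  choose f hf using left_total
  have heq (a : α) (b : β) : r a b ↔ f a = b := by
    refine ⟨fun hb => ?_, fun hb => hb ▸ hf a⟩
    exact le_antisymm ((le_iff_le _ _ (hf a) _ _ hb).1 le_rfl)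
      ((le_iff_le _ _ hb _ _ (hf a)).1 le_rfl)
  have hsurj : Function.Surjective f := fun b => (right_total b).imp fun a => (heq a b).1
  let e : α ↪o β := OrderEmbedding.ofMapLEIff f fun a a' => (le_iff_le _ _ (hf a) _ _ (hf a')).symm
  exact ⟨RelIso.ofSurjective e hsurj, heq⟩

/-- The set of pairs `σ` matches the element with code `i` of either side with something. -/
def Covers {M N : Type*} [Encodable M] [Encodable N] (σ : List (M × N)) (i : ℕ) : Prop :=
  (∀ x : M, encode x = i → ∃ y, (x, y) ∈ σ) ∧ ∀ y : N, encode y = i → ∃ x, (x, y) ∈ σ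

section BackAndForth

variable {M N : Type*} [Encodable M] [Encodable N] {O : Set (ℕ →. ℕ)} {n : ℕ}

theorem deltaPred_covers [EnumerableCodes O M] [EnumerableCodes O N] :
    DeltaPred O (n + 2) fun x : List (M × N) × ℕ => Covers x.1 x.2 :=
  .and (.forall_encode_eq (by fun_prop) (.ex (.mem (by fun_prop) (by fun_prop))))
    (.forall_encode_eq (by fun_prop) (.ex (.mem (by fun_prop) (by fun_prop))))

theorem exists_covers_of_extend {G : List (M × N) → Prop}
    (extend_left : ∀ σ, G σ → ∀ x, ∃ y, G ((x, y) :: σ))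
    (extend_right : ∀ σ, G σ → ∀ y, ∃ x, G ((x, y) :: σ)) {σ : List (M × N)} (hσ : G σ) (i : ℕ) :
    ∃ τ, σ ⊆ τ ∧ G τ ∧ Covers τ i := by
  obtain ⟨ρ, hσρ, hρ, hleft⟩ : ∃ ρ, σ ⊆ ρ ∧ G ρ ∧ ∀ x : M, encode x = i → ∃ y, (x, y) ∈ ρ := by
    by_cases hi : ∃ x : M, encode x = i
    · obtain ⟨x, rfl⟩ := hi
      obtain ⟨y, hy⟩ := extend_left σ hσ x
      exact ⟨_, List.subset_cons_self _ _, hy, fun x' hx => ⟨y, by simp [encode_injective hx]⟩⟩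
    · exact ⟨σ, List.Subset.refl σ, hσ, fun x hx => absurd ⟨x, hx⟩ hi⟩
  by_cases hi : ∃ y : N, encode y = i
  · obtain ⟨y, rfl⟩ := hi
    obtain ⟨x, hx⟩ := extend_right ρ hρ y
    refine ⟨_, List.subset_cons_of_subset _ hσρ, hx, fun x' hx' => ?_, fun y' hy => ⟨x, ?_⟩⟩
    · exact (hleft x' hx').imp fun _ => List.mem_cons_of_mem _
    · simp [encode_injective hy]
  · exact ⟨ρ, hσρ, hρ, hleft, fun y hy => absurd ⟨y, hy⟩ hi⟩

theorem exists_orderIso_deltaFun [PartialOrder M] [PartialOrder N] [EnumerableCodes O M]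
    [EnumerableCodes O N] {G : List (M × N) → Prop} (hG : DeltaPred O (n + 2) G)
    (le_iff_le : ∀ σ, G σ → ∀ a ∈ σ, ∀ b ∈ σ, a.1 ≤ b.1 ↔ a.2 ≤ b.2)
    (extend_left : ∀ σ, G σ → ∀ x, ∃ y, G ((x, y) :: σ))
    (extend_right : ∀ σ, G σ → ∀ y, ∃ x, G ((x, y) :: σ)) {σ₀ : List (M × N)} (hσ₀ : G σ₀) :
    ∃ f : M ≃o N, DeltaFun O (n + 2) f := by
  let r (x : ℕ × List (M × N)) (τ : List (M × N)) : Prop :=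
    G x.2 → x.2 ⊆ τ ∧ G τ ∧ Covers τ x.1
  have hr : DeltaPred O (n + 2) fun x : (ℕ × List (M × N)) × List (M × N) => r x.1 x.2 :=
    .imp (hG.comp (by fun_prop)) (.and (.subset (by fun_prop) (by fun_prop))
      (.and (hG.comp (by fun_prop)) (deltaPred_covers.comp
        (f := fun x : (ℕ × List (M × N)) × List (M × N) => (x.2, x.1.1)) (by fun_prop))))
  have hex (x : ℕ × List (M × N)) : ∃ τ, r x τ := by
    by_cases hx : G x.2
    · obtain ⟨τ, hτ⟩ := exists_covers_of_extend extend_left extend_right hx x.1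
      exact ⟨τ, fun _ => hτ⟩
    · exact ⟨[], fun h => absurd h hx⟩
  obtain ⟨F, hF, rfl, hFr⟩ := hr.exists_deltaFun_chain hex σ₀
  have hFG (i : ℕ) : G (F i) := by
    induction i with
    | zero => exact hσ₀
    | succ i ih => exact (hFr i ih).2.1
  have hcovers (i : ℕ) : Covers (F (i + 1)) i := (hFr i (hFG i)).2.2
  have hmono : Monotone fun i => {a | a ∈ F i} :=
    monotone_nat_of_le_succ fun i _ ha => (hFr i (hFG i)).1 ha
  obtain ⟨f, hf⟩ := exists_orderIso_of_rel (r := fun x y => ∃ i, (x, y) ∈ F i)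
    (fun x => ((hcovers (encode x)).1 x rfl).imp fun _ h => ⟨_, h⟩)
    (fun y => ((hcovers (encode y)).2 y rfl).imp fun _ h => ⟨_, h⟩)
    fun _ _ ⟨i, hi⟩ _ _ ⟨j, hj⟩ =>
      le_iff_le _ (hFG (max i j)) _ (hmono (le_max_left i j) hi) _ (hmono (le_max_right i j) hj)
  have hgraph : SigmaPred O (n + 2) fun x : M × N => ∃ i, x ∈ F i :=
    .ex (.comp_deltaFun (f := fun x : (M × N) × ℕ => F x.2) (r := fun x σ => x.1 ∈ σ)
      (DeltaPred.mem (by fun_prop) (by fun_prop)).1 (hF.comp (by fun_prop)))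
  exact ⟨f, hgraph.of_iff fun ⟨x, y⟩ => (hf x y).symm⟩

end BackAndForth

/-! ### Matchings of sp-orderings -/

section SPWords

variable {L M N : Type*} [LinearOrder L] [LinearOrder M] [LinearOrder N]

theorem spSucc_eq_iff {x y : M} : spSucc x = y ↔ x ⋖ y ∨ (y = x ∧ ∀ z, ¬ x ⋖ z) := by
  unfold spSucc
  split_ifs with h
  · refine ⟨fun hy => Or.inl (hy ▸ h.choose_spec), ?_⟩
    rintro (hy | hy)
    · exact h.choose_spec.unique_right hy
    · exact absurd h.choose_spec (hy.2 _)
  · push Not at h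
    simp [h, eq_comm]

theorem spPred_eq_iff {x y : M} : spPred x = y ↔ y ⋖ x ∨ (y = x ∧ ∀ z, ¬ z ⋖ x) := by
  unfold spPred
  split_ifs with h
  · refine ⟨fun hy => Or.inl (hy ▸ h.choose_spec), ?_⟩
    rintro (hy | hy)
    · exact h.choose_spec.unique_left hy
    · exact absurd h.choose_spec (hy.2 _)
  · push Not at h
    simp [h, eq_comm]

theorem map_spSucc (e : M ≃o N) (x : M) : e (spSucc x) = spSucc (e x) := by
  symm
  rw [spSucc_eq_iff, e.surjective.forall]
  simpa only [apply_covBy_apply_iff, EmbeddingLike.apply_eq_iff_eq] using spSucc_eq_iff.1 rfl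

theorem map_spPred (e : M ≃o N) (x : M) : e (spPred x) = spPred (e x) := by
  symm
  rw [spPred_eq_iff, e.surjective.forall]
  simpa only [apply_covBy_apply_iff, EmbeddingLike.apply_eq_iff_eq] using spPred_eq_iff.1 rfl

/-- The letter `true` acts as the successor function, the letter `false` as the predecessor. -/
noncomputable def spStep (x : M) : Bool → M
  | true => spSucc x
  | false => spPred x

/-- The action of a word in the successor and predecessor functions, read from left to right. These
actions are the unary terms of the language of sp-linear orderings. -/
noncomputable def spAct (w : List Bool) (x : M) : M := w.foldl spStep x

theorem map_spStep (e : M ≃o N) (x : M) (c : Bool) : e (spStep x c) = spStep (e x) c :=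
  match c with
  | true => map_spSucc e x
  | false => map_spPred e x

theorem map_spAct (e : M ≃o N) (w : List Bool) (x : M) : e (spAct w x) = spAct w (e x) := by
  induction w generalizing x with
  | nil => rfl
  | cons c w ih =>
    calc e (spAct w (spStep x c)) = spAct w (e (spStep x c)) := ih _
      _ = spAct w (spStep (e x) c) := by rw [map_spStep]

theorem spAct_append_singleton (w : List Bool) (c : Bool) (x : M) :
    spAct (w ++ [c]) x = spStep (spAct w x) c := by
  simp only [spAct, List.foldl_append, List.foldl_cons, List.foldl_nil]

theorem spStep_mem (S : letI := spStructure L; spLanguage.Substructure L) {x : L} (hx : x ∈ S)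
    (c : Bool) : spStep x c ∈ S := by
  let := spStructure L
  cases c with
  | true => exact S.fun_mem (SPFunc.s : spLanguage.Functions 1) (fun _ => x) fun _ => hx
  | false => exact S.fun_mem (SPFunc.p : spLanguage.Functions 1) (fun _ => x) fun _ => hx

theorem mem_closure_iff_exists_spAct (s : Set L) (x : L) :
    letI := spStructure L
    x ∈ Language.Substructure.closure spLanguage s ↔ ∃ w, ∃ a ∈ s, spAct w a = x := by
  let := spStructure L
  constructor
  · intro hx
    have hstep (y : L) (c : Bool) : (∃ w, ∃ a ∈ s, spAct w a = y) →
        ∃ w, ∃ a ∈ s, spAct w a = spStep y c := by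
      rintro ⟨w, a, ha, rfl⟩
      exact ⟨w ++ [c], a, ha, spAct_append_singleton w c a⟩
    refine Language.Substructure.closure_induction hx (fun a ha => ⟨[], a, ha, rfl⟩) ?_
    intro n f v hv
    cases f with
    | s => exact hstep (v 0) true (hv 0)
    | p => exact hstep (v 0) false (hv 0)
  · rintro ⟨w, a, ha, rfl⟩
    induction w using List.reverseRecOn with
    | nil => exact Language.Substructure.subset_closure ha
    | append_singleton w c ih => exact spAct_append_singleton w c a ▸ spStep_mem _ ih c

/-- The two sides of the set of pairs `σ` satisfy the same atomic formulas in the language of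
sp-linear orderings; equations need not be mentioned because `≤` is antisymmetric. -/
def IsSPMatching (σ : Set (M × N)) : Prop :=
  ∀ a ∈ σ, ∀ b ∈ σ, ∀ v w : List Bool, spAct v a.1 ≤ spAct w b.1 ↔ spAct v a.2 ≤ spAct w b.2

namespace IsSPMatching

theorem of_orderIso {σ : Set (M × N)} (e : M ≃o N) (h : ∀ a ∈ σ, e a.1 = a.2) :
    IsSPMatching σ := fun _ ha _ hb v w => by
  rw [← h _ ha, ← h _ hb, ← map_spAct, ← map_spAct, e.le_iff_le]

theorem image {M' N' : Type*} [LinearOrder M'] [LinearOrder N'] {σ : Set (M × N)}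
    (h : IsSPMatching σ) (e : M ≃o M') (e' : N ≃o N') : IsSPMatching (Prod.map e e' '' σ) := by
  rintro _ ⟨a, ha, rfl⟩ _ ⟨b, hb, rfl⟩ v w
  simpa only [Prod.map_fst, Prod.map_snd, ← map_spAct, OrderIso.le_iff_le] using h a ha b hb v w

theorem exists_equiv_closure {σ : Set (L × L)} (h : IsSPMatching σ) :
    letI := spStructure L
    ∃ f : Language.Substructure.closure spLanguage (Prod.fst '' σ) ≃[spLanguage]
      Language.Substructure.closure spLanguage (Prod.snd '' σ),
        ∀ a ∈ σ, ∀ ha, (f ⟨a.1, ha⟩ : L) = a.2 := by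
  let := spStructure L
  let S := Language.Substructure.closure spLanguage (Prod.fst '' σ)
  let T := Language.Substructure.closure spLanguage (Prod.snd '' σ)
  let r (x : S) (y : T) : Prop := ∃ w, ∃ a ∈ σ, spAct w a.1 = x ∧ spAct w a.2 = y
  have left_total (x : S) : ∃ y, r x y := by
    obtain ⟨w, _, ⟨a, ha, rfl⟩, hw⟩ := (mem_closure_iff_exists_spAct _ _).1 x.2
    exact ⟨⟨_, (mem_closure_iff_exists_spAct _ _).2 ⟨w, _, ⟨a, ha, rfl⟩, rfl⟩⟩, w, a, ha, hw, rfl⟩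
  have right_total (y : T) : ∃ x, r x y := by
    obtain ⟨w, _, ⟨a, ha, rfl⟩, hw⟩ := (mem_closure_iff_exists_spAct _ _).1 y.2
    exact ⟨⟨_, (mem_closure_iff_exists_spAct _ _).2 ⟨w, _, ⟨a, ha, rfl⟩, rfl⟩⟩, w, a, ha, rfl, hw⟩
  have le_iff_le (x : S) (y : T) : r x y → ∀ x' y', r x' y' → (x ≤ x' ↔ y ≤ y') := by
    rintro ⟨v, a, ha, hx, hy⟩ x' y' ⟨w, b, hb, hx', hy'⟩
    rw [← Subtype.coe_le_coe, ← Subtype.coe_le_coe, ← hx, ← hy, ← hx', ← hy']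
    exact h a ha b hb v w
  obtain ⟨e, he⟩ := exists_orderIso_of_rel left_total right_total le_iff_le
  have map_step (x : S) (c : Bool) : e ⟨_, spStep_mem S x.2 c⟩ = ⟨_, spStep_mem T (e x).2 c⟩ := by
    obtain ⟨w, a, ha, hx, hy⟩ := (he x (e x)).2 rfl
    exact (he _ _).1 ⟨w ++ [c], a, ha, by rw [spAct_append_singleton, hx],
      by rw [spAct_append_singleton, hy]⟩
  refine ⟨⟨e.toEquiv, ?_, ?_⟩, fun a ha hS => ?_⟩
  · rintro n (_ | _) v
    exacts [map_step (v 0) true, map_step (v 0) false]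
  · rintro n ⟨⟩ v
    exact e.le_iff_le
  · have haT : a.2 ∈ T := Language.Substructure.subset_closure ⟨a, ha, rfl⟩
    exact congrArg Subtype.val ((he ⟨a.1, hS⟩ ⟨a.2, haT⟩).1 ⟨[], a, ha, rfl, rfl⟩)

end IsSPMatching

theorem WeaklySPHomogeneous.exists_automorphism (hL : WeaklySPHomogeneous L) :
    ∃ E : Finset L, ∀ σ : Set (L × L), σ.Finite → IsSPMatching σ → (∀ x ∈ E, (x, x) ∈ σ) →
      ∃ g : L ≃o L, ∀ a ∈ σ, g a.1 = a.2 := by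
  let := spStructure L
  obtain ⟨E, hE⟩ := hL
  refine ⟨E, fun σ hσ h hEσ => ?_⟩
  obtain ⟨f, hf⟩ := h.exists_equiv_closure
  have hmem : ∀ a ∈ σ, a.1 ∈ Language.Substructure.closure spLanguage (Prod.fst '' σ) :=
    fun a ha => Language.Substructure.subset_closure ⟨a, ha, rfl⟩
  obtain ⟨g, hg⟩ := hE _ _ (Language.Substructure.fg_closure (hσ.image _))
    (Language.Substructure.fg_closure (hσ.image _)) f
    fun x hx => ⟨hmem _ (hEσ x hx), hf _ (hEσ x hx) _⟩
  refine ⟨⟨g.toEquiv, fun {x y} => ?_⟩, fun a ha => ?_⟩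
  · exact g.map_rel (Language.orderRel.le : spLanguage.Relations 2) ![x, y]
  · exact (hg ⟨a.1, hmem a ha⟩).trans (hf a ha _)

theorem WeaklySPHomogeneous.exists_list_orderIso (hL : WeaklySPHomogeneous L) (e : L ≃o M)
    (e' : L ≃o N) : ∃ σ₀ : List (M × N), IsSPMatching {a | a ∈ σ₀} ∧
      ∀ σ : List (M × N), IsSPMatching {a | a ∈ σ} → σ₀ ⊆ σ →
        ∃ k : M ≃o N, ∀ a ∈ σ, k a.1 = a.2 := by
  obtain ⟨E, hE⟩ := hL.exists_automorphism
  refine ⟨E.toList.map fun x => (e x, e' x), ?_, fun σ h hsub => ?_⟩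
  · exact .of_orderIso (e.symm.trans e') (by simp)
  · have hmem : ∀ x ∈ E, (x, x) ∈ Prod.map e.symm e'.symm '' {a | a ∈ σ} := fun x hx =>
      ⟨(e x, e' x), hsub (List.mem_map.2 ⟨x, Finset.mem_toList.2 hx, rfl⟩), by simp⟩
    obtain ⟨g, hg⟩ := hE _ (σ.finite_toSet.image _) (h.image e.symm e'.symm) hmem
    refine ⟨(e.symm.trans g).trans e', fun a ha => ?_⟩
    have hga : g (e.symm a.1) = e'.symm a.2 := hg _ ⟨a, ha, rfl⟩
    simp [hga]

theorem WeaklySPHomogeneous.exists_isSPMatching_cons (hL : WeaklySPHomogeneous L) (e : L ≃o M)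
    (e' : L ≃o N) : ∃ σ₀ : List (M × N), IsSPMatching {a | a ∈ σ₀} ∧
      ∀ σ : List (M × N), IsSPMatching {a | a ∈ σ} → σ₀ ⊆ σ →
        (∀ x, ∃ y, IsSPMatching {a | a ∈ (x, y) :: σ}) ∧
          ∀ y, ∃ x, IsSPMatching {a | a ∈ (x, y) :: σ} := by
  obtain ⟨σ₀, hσ₀, hext⟩ := hL.exists_list_orderIso e e'
  refine ⟨σ₀, hσ₀, fun σ h hsub => ?_⟩
  obtain ⟨k, hk⟩ := hext σ h hsub
  exact ⟨fun x => ⟨k x, .of_orderIso k (List.forall_mem_cons.2 ⟨rfl, hk⟩)⟩,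
    fun y => ⟨k.symm y, .of_orderIso k (List.forall_mem_cons.2 ⟨k.apply_symm_apply y, hk⟩)⟩⟩

end SPWords

/-! ### Definability in presentations -/

namespace OrderPresentation

section Presentation

variable {P Q : OrderPresentation}

theorem Elem.toNat_injective : Function.Injective (Elem.toNat : P.Elem → ℕ) :=
  Subtype.val_injective

noncomputable instance : Encodable P.Elem := .ofInj Elem.toNat Elem.toNat_injective

theorem diagram_encode_eq_one_iff (x : P.Elem × P.Elem) :
    P.diagram (encode x) = 1 ↔ x.1 ≤ x.2 := by
  unfold diagram
  split_ifs with h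
  · obtain ⟨a, b, hab, hle⟩ := h
    obtain rfl : x = (a, b) := encode_injective hab
    simp [hle]
  · exact iff_of_false id fun hle => h ⟨x.1, x.2, rfl, hle⟩

theorem range_encode_elem :
    Set.range (encode : P.Elem → ℕ) = {m | P.diagram (Nat.pair m m) = 1} := by
  ext m
  simp only [Set.mem_range, Set.mem_ofPred_eq]
  constructor
  · rintro ⟨a, rfl⟩
    exact (diagram_encode_eq_one_iff (a, a)).2 le_rfl
  · intro h
    obtain ⟨a, b, hab, -⟩ : ∃ a b : P.Elem, Nat.pair m m = Nat.pair a.toNat b.toNat ∧ a ≤ b :=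
      of_not_not fun hne => zero_ne_one ((if_neg hne).symm.trans h)
    exact ⟨a, (Nat.pair_eq_pair.1 hab).1.symm⟩

theorem isoGraph_eq_image (f : P.Elem ≃o Q.Elem) :
    isoGraph f = encode '' {x : P.Elem × Q.Elem | f x.1 = x.2} := by
  ext m
  constructor
  · rintro ⟨a, rfl⟩
    exact ⟨(a, f a), rfl, rfl⟩
  · rintro ⟨⟨a, b⟩, hb : f a = b, rfl⟩
    exact ⟨a, hb ▸ rfl⟩

end Presentation

section Definability

variable {P Q : OrderPresentation} {O : Set (ℕ →. ℕ)} [hP : Fact ((P.diagram : ℕ →. ℕ) ∈ O)]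

theorem isSigma_zero_diagram_eq_one : IsSigma O 0 {m | P.diagram m = 1} := by
  have h : ComputableIn O fun m => decide (P.diagram m = 1) :=
    computableIn_comp (g := fun k => decide (k = 1))
      (Primrec.eq.comp Primrec.id (Primrec.const 1)).decide.computableIn
      (RecursiveIn.oracle _ hP.out)
  simpa only [decide_eq_true_eq] using IsSigma.of_computableIn h

instance : EnumerableCodes O P.Elem where
  isSigma_range_encode := by
    rw [range_encode_elem]
    exact (isSigma_zero_diagram_eq_one.preimage
      (Primrec₂.natPair.to_comp.comp Computable.id Computable.id)).succ

theorem deltaPred_le {n : ℕ} : DeltaPred O n fun x : P.Elem × P.Elem => x.1 ≤ x.2 := by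
  have h : SigmaPred O 0 fun x : P.Elem × P.Elem => x.1 ≤ x.2 :=
    ⟨_, isSigma_zero_diagram_eq_one, fun x => (diagram_encode_eq_one_iff x).symm⟩
  exact ⟨h.mono n.zero_le, h.not_zero.mono n.zero_le⟩

theorem deltaPred_le_of_deltaFun {α : Type*} [Encodable α] {n : ℕ} {f g : α → P.Elem}
    (hf : DeltaFun O (n + 1) f) (hg : DeltaFun O (n + 1) g) :
    DeltaPred O (n + 1) fun a => f a ≤ g a := by
  have hle : DeltaPred O (n + 1) fun x : α × P.Elem => f x.1 ≤ x.2 :=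
    .comp_deltaFun (f := fun x : α × P.Elem => f x.1) (r := fun x b => b ≤ x.2)
      (deltaPred_le.comp (f := fun x : (α × P.Elem) × P.Elem => (x.2, x.1.2)) (by fun_prop))
      (hf.comp (by fun_prop))
  exact hle.comp_deltaFun (r := fun a b => f a ≤ b) hg

theorem deltaPred_lt {n : ℕ} : DeltaPred O n fun x : P.Elem × P.Elem => x.1 < x.2 := by
  simpa only [not_le] using
    (deltaPred_le.comp (f := fun x : P.Elem × P.Elem => (x.2, x.1)) (by fun_prop)).not

theorem deltaPred_covBy : DeltaPred O 2 fun x : P.Elem × P.Elem => x.1 ⋖ x.2 :=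
  .and deltaPred_lt (.all (.imp
    (deltaPred_lt.comp (f := fun x : (P.Elem × P.Elem) × P.Elem => (x.1.1, x.2)) (by fun_prop))
    (deltaPred_lt.comp
      (f := fun x : (P.Elem × P.Elem) × P.Elem => (x.2, x.1.2)) (by fun_prop)).not))

theorem deltaFun_spSucc : DeltaFun O 3 (spSucc : P.Elem → P.Elem) := by
  simp only [DeltaFun, spSucc_eq_iff]
  exact (DeltaPred.or (deltaPred_covBy.mono (by omega)) (.and (.eq (by fun_prop) (by fun_prop))
    (.all (deltaPred_covBy.comp (f := fun x : (P.Elem × P.Elem) × P.Elem => (x.1.1, x.2))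
      (by fun_prop)).not))).1

theorem deltaFun_spPred : DeltaFun O 3 (spPred : P.Elem → P.Elem) := by
  simp only [DeltaFun, spPred_eq_iff]
  exact (DeltaPred.or ((deltaPred_covBy.comp
      (f := fun x : P.Elem × P.Elem => (x.2, x.1)) (by fun_prop)).mono (by omega))
    (.and (.eq (by fun_prop) (by fun_prop))
      (.all (deltaPred_covBy.comp (f := fun x : (P.Elem × P.Elem) × P.Elem => (x.2, x.1.1))
        (by fun_prop)).not))).1

theorem deltaFun_spStep : DeltaFun O 3 fun x : P.Elem × Bool => spStep x.1 x.2 := by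
  have hcases : SigmaPred O 3 fun x : (P.Elem × Bool) × P.Elem =>
      (x.1.2 = true ∧ spSucc x.1.1 = x.2) ∨ (x.1.2 = false ∧ spPred x.1.1 = x.2) :=
    .or (.and (.eq (by fun_prop) (by fun_prop))
        (deltaFun_spSucc.comp_eq (by fun_prop) (by fun_prop)))
      (.and (.eq (by fun_prop) (by fun_prop))
        (deltaFun_spPred.comp_eq (by fun_prop) (by fun_prop)))
  refine hcases.of_iff fun ⟨⟨_, c⟩, _⟩ => ?_
  cases c <;> simp [spStep]

theorem deltaFun_spAct : DeltaFun O 3 fun x : List Bool × P.Elem => spAct x.1 x.2 :=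
  deltaFun_spStep.foldl

theorem deltaPred_spAct_le {α : Type*} [Encodable α] {v w : α → List Bool} {f g : α → P.Elem}
    (hv : CodeComputable v) (hf : CodeComputable f) (hw : CodeComputable w)
    (hg : CodeComputable g) : DeltaPred O 3 fun a => spAct (v a) (f a) ≤ spAct (w a) (g a) :=
  deltaPred_le_of_deltaFun (deltaFun_spAct.comp (f := fun a => (v a, f a)) (by fun_prop))
    (deltaFun_spAct.comp (f := fun a => (w a, g a)) (by fun_prop))

theorem deltaPred_isSPMatching [Fact ((Q.diagram : ℕ →. ℕ) ∈ O)] : DeltaPred O 4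
    fun σ : List (P.Elem × Q.Elem) => IsSPMatching {a | a ∈ σ} := by
  have hall : DeltaPred O 4 fun σ : List (P.Elem × Q.Elem) =>
      ∀ x : ((P.Elem × Q.Elem) × P.Elem × Q.Elem) × List Bool × List Bool,
        x.1.1 ∈ σ → x.1.2 ∈ σ →
          (spAct x.2.1 x.1.1.1 ≤ spAct x.2.2 x.1.2.1 ↔ spAct x.2.1 x.1.1.2 ≤ spAct x.2.2 x.1.2.2) :=
    .all (.imp (.mem (by fun_prop) (by fun_prop)) (.imp (.mem (by fun_prop) (by fun_prop))
      (.iff (deltaPred_spAct_le (by fun_prop) (by fun_prop) (by fun_prop) (by fun_prop))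
        (deltaPred_spAct_le (by fun_prop) (by fun_prop) (by fun_prop) (by fun_prop)))))
  convert hall using 2 with σ
  exact ⟨fun h x hx hy => h _ hx _ hy _ _, fun h a ha b hb v w => h ((a, b), v, w) ha hb⟩

end Definability

end OrderPresentation

theorem mainTheorem10 {L : Type*} [LinearOrder L] [Countable L] (hL : WeaklySPHomogeneous L) :
    RelativelyDeltaCategorical 4 L := by
  rintro P Q ⟨e⟩ ⟨e'⟩
  have hP : Fact ((P.diagram : ℕ →. ℕ) ∈ ({↑P.diagram, ↑Q.diagram} : Set (ℕ →. ℕ))) := ⟨.inl rfl⟩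
  have hQ : Fact ((Q.diagram : ℕ →. ℕ) ∈ ({↑P.diagram, ↑Q.diagram} : Set (ℕ →. ℕ))) := ⟨.inr rfl⟩
  obtain ⟨σ₀, hσ₀, hext⟩ := hL.exists_isSPMatching_cons e e'
  let G (σ : List (P.Elem × Q.Elem)) : Prop := σ₀ ⊆ σ ∧ IsSPMatching {a | a ∈ σ}
  have hG : DeltaPred {↑P.diagram, ↑Q.diagram} 4 G :=
    .and (.subset (by fun_prop) (by fun_prop)) OrderPresentation.deltaPred_isSPMatching
  have le_iff_le (σ) (hσ : G σ) (a) (ha : a ∈ σ) (b) (hb : b ∈ σ) : a.1 ≤ b.1 ↔ a.2 ≤ b.2 :=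
    hσ.2 a ha b hb [] []
  have extend_left (σ) (hσ : G σ) (x) : ∃ y, G ((x, y) :: σ) :=
    ((hext σ hσ.2 hσ.1).1 x).imp fun _ h => ⟨List.subset_cons_of_subset _ hσ.1, h⟩
  have extend_right (σ) (hσ : G σ) (y) : ∃ x, G ((x, y) :: σ) :=
    ((hext σ hσ.2 hσ.1).2 y).imp fun _ h => ⟨List.subset_cons_of_subset _ hσ.1, h⟩
  obtain ⟨f, hf⟩ :=
    exists_orderIso_deltaFun hG le_iff_le extend_left extend_right ⟨List.Subset.refl σ₀, hσ₀⟩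
  exact ⟨f, OrderPresentation.isoGraph_eq_image f ▸ hf.deltaPred_graph.isDelta_image⟩
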